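/- Let $H$ be a real Hilbert space with inner product $(\cdot,\cdot)_H$, let $T>0$, and let $\mathcal F:[0,T]\times H\to H$ be continuous. Let $H_m\subset H$ be a finite-dimensional subspace with $H$-orthogonal projection $\pi_m:H\to H_m$, let $t_{m-1}\in[0,T)$ be a time node, and let $U_{m-1}\in H$ (for the cG scheme) and $U_{m-1}^-\in H$ (for the dG scheme) be given values. For $k_m>0$ with $t_m:=t_{m-1}+k_m\le T$ put $I_m=(t_{m-1},t_m)$, and for $r\in\mathbb N_0$ let $\mathcal P^r(I_m;H_m)$ be the space of functions $p\in C^0(\overline{I_m};H_m)$ of the form $p(t)=\sum_{i=0}^r x_it^i$ with $x_i\in H_m$. For a continuous function $V$ on $\overline{I_m}$ write $V_{m-1}^+=\lim_{s\searrow0}V(t_{m-1}+s)$. Then there is a constant $k_{\max}>0$, depending on $\mathcal F$, $T$, $H_m$, $t_{m-1}$, $U_{m-1}$ and $U_{m-1}^-$ but not on any polynomial degree, such that for every $0<k_m\le k_{\max}$ with $t_{m-1}+k_m\le T$ and every $r_m\in\mathbb N_0$ the following hold. (cG) There is at least one $U\in\mathcal P^{r_m+1}(I_m;H_m)$ with $U(t_{m-1})=\pi_mU_{m-1}$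 and $$\int_{I_m}(U'(t),V(t))_H\,dt=\int_{I_m}(\mathcal F(t,U(t)),V(t))_H\,dt\qquad\forall V\in\mathcal P^{r_m}(I_m;H_m).$$ (dG) There is at least one $U\in\mathcal P^{r_m}(I_m;H_m)$ with $$\int_{I_m}(U'(t),V(t))_H\,dt+(U_{m-1}^+-U_{m-1}^-,V_{m-1}^+)_H=\int_{I_m}(\mathcal F(t,U(t)),V(t))_H\,dt\qquad\forall V\in\mathcal P^{r_m}(I_m;H_m).$$ -/

import Mathlib

namespace GalerkinTimeStepping

variable {H : Type*} [NormedAddCommGroup H] [InnerProductSpace ℝ H]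

/-- The space `𝒫^r(J; X)` of polynomials of degree at most `r` on the closure of `J`, with
coefficients in the subspace `X` of `H`. Its elements are represented by functions on `ℝ`;
the values outside the closure of `J` are irrelevant. -/
def polySpace (r : ℕ) (J : Set ℝ) (X : Submodule ℝ H) : Set (ℝ → H) :=
  {p | ContinuousOn p (closure J) ∧
    ∃ x : Fin (r + 1) → X, ∀ t ∈ closure J, p t = ∑ i : Fin (r + 1), t ^ (i : ℕ) • (x i : H)}

/-- `U` solves the local `hp`-cG problem on `I = (a, a + k)` for the nonlinearity `F`, the
finite-dimensional space `Hm`, the degree `r` and the given value `Uprev` at the node `a`. -/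
structure IsCGSolution (F : ℝ → H → H) (Hm : Submodule ℝ H) [FiniteDimensional ℝ Hm]
    (a k : ℝ) (r : ℕ) (Uprev : H) (U : ℝ → H) : Prop where
  mem : U ∈ polySpace (r + 1) (Set.Ioo a (a + k)) Hm
  initial : U a = Hm.starProjection Uprev
  weak : ∀ V ∈ polySpace r (Set.Ioo a (a + k)) Hm,
    ∫ t in Set.Ioo a (a + k), inner ℝ (deriv U t) (V t) =
      ∫ t in Set.Ioo a (a + k), inner ℝ (F t (U t)) (V t)

/-- `U` solves the local `hp`-dG problem on `I = (a, a + k)` for the nonlinearity `F`, the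
finite-dimensional space `Hm`, the degree `r` and the given left-hand limit `Uprev` at the
node `a`. The jump at `a` is the right-hand limit of `U` at `a` minus `Uprev`. -/
structure IsDGSolution (F : ℝ → H → H) (Hm : Submodule ℝ H)
    (a k : ℝ) (r : ℕ) (Uprev : H) (U : ℝ → H) : Prop where
  mem : U ∈ polySpace r (Set.Ioo a (a + k)) Hm
  weak : ∀ V ∈ polySpace r (Set.Ioo a (a + k)) Hm,
    (∫ t in Set.Ioo a (a + k), inner ℝ (deriv U t) (V t)) +
        inner ℝ (Function.rightLim U a - Uprev) (Function.rightLim V a) =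
      ∫ t in Set.Ioo a (a + k), inner ℝ (F t (U t)) (V t)

end GalerkinTimeStepping

/-!
After projecting `F` to `Hm` and rescaling time to the unit interval, the right-hand side is `k`
times a continuous map. A Tietze extension from a compact neighbourhood of the initial value makes
it bounded by `O(k)` without changing it at functions that stay within distance `1` of the initial
value `u₀ = π Uprev`, so it suffices to solve the truncated problem with a solution that does.

With the discrete derivative `Z`, a polynomial of degree `r`, as the unknown, the truncated problem
says that `Z` is the `L²`-orthogonal projection of the right-hand side. Brouwer's fixed point
theorem gives a solution, and it satisfies `‖Z‖ ≤ O(k)` in `L²`, whatever the degree is. For the cG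
scheme `U - u₀` is the primitive of `Z`, which is then also `O(k)` in the supremum norm. For the dG
scheme the jump `c` is absorbed into the derivative: `U - u₀` is the primitive of `Z` plus `ρ c`,
where `ρ` is the Radau polynomial of degree `r + 1` with `ρ(0) = 1` and `ρ(1) = 0`, for which
`∫ ρ' q = -q(0)` for all `q` of degree at most `r`. Since `|ρ| ≤ 1` on `[0, 1]`, the supremum norm
of `ρ c` is at most `|c|`, and testing with `U - u₀` gives `|c| ≤ 3 ‖Z‖`.
-/

namespace GalerkinTimeStepping

open MeasureTheory Set Metric Filter
open scoped NNReal Polynomial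

section Brouwer

variable {E : Type*} [NormedAddCommGroup E]

theorem bijective_id_add_of_lipschitzWith [CompleteSpace E] {K : ℝ≥0} {g : E → E}
    (hg : LipschitzWith K g) (hK : K < 1) : Function.Bijective fun x => x + g x := by
  have hsub (y : E) : ContractingWith K fun x => y - g x :=
    ⟨hK, LipschitzWith.of_dist_le_mul fun x z => by
      simpa only [dist_sub_left] using hg.dist_le_mul x z⟩
  refine ⟨fun x y hxy => ?_, fun y => ?_⟩
  · refine (hsub (x + g x)).fixedPoint_unique' (x := x) (y := y) ?_ ?_
    · exact add_sub_cancel_right x (g x)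
    · exact sub_eq_of_eq_add hxy
  · obtain ⟨x, hx⟩ : ∃ x, y - g x = x := ⟨_, (hsub y).fixedPoint_isFixedPt⟩
    exact ⟨x, (sub_eq_iff_eq_add.1 hx).symm⟩

variable [NormedSpace ℝ E]

theorem exists_mem_segment_inter_frontier {s : Set E} {x y : E} (hx : x ∈ s) (hy : y ∉ s) :
    ∃ z ∈ segment ℝ x y, z ∈ frontier s := by
  obtain ⟨z, hz, hzs⟩ := isPreconnected_closed_iff.1 (convex_segment x y).isPreconnected
    (closure s) (closure sᶜ) isClosed_closure isClosed_closure
    (fun z _ => (em (z ∈ s)).imp (@subset_closure E _ s z) (@subset_closure E _ sᶜ z))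
    ⟨x, left_mem_segment ℝ x y, subset_closure hx⟩ ⟨y, right_mem_segment ℝ x y, subset_closure hy⟩
  exact ⟨z, hz, by rwa [frontier_eq_closure_inter_closure]⟩

theorem lipschitzWith_indicator {s : Set E} {K : ℝ≥0} {g : E → E}
    (hg : LipschitzOnWith K g (closure s)) (h0 : EqOn g 0 (frontier s)) :
    LipschitzWith K (s.indicator g) := by
  have norm_le {x y : E} (hx : x ∈ s) (hy : y ∉ s) : ‖g x‖ ≤ K * dist x y := by
    obtain ⟨z, hz, hzs⟩ := exists_mem_segment_inter_frontier hx hy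
    calc ‖g x‖ = dist (g x) (g z) := by rw [h0 hzs, Pi.zero_apply, dist_zero_right]
      _ ≤ K * dist x z := hg.dist_le_mul x (subset_closure hx) z (frontier_subset_closure hzs)
      _ ≤ K * dist x y := by
        gcongr
        linarith [dist_add_dist_of_mem_segment hz, dist_nonneg (x := z) (y := y)]
  refine LipschitzWith.of_dist_le_mul fun x y => ?_
  by_cases hx : x ∈ s <;> by_cases hy : y ∈ s
  · rw [indicator_of_mem hx, indicator_of_mem hy]
    exact hg.dist_le_mul x (subset_closure hx) y (subset_closure hy)
  · rw [indicator_of_mem hx, indicator_of_notMem hy, dist_zero_right]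
    exact norm_le hx hy
  · rw [indicator_of_notMem hx, indicator_of_mem hy, dist_zero_left, dist_comm]
    exact norm_le hy hx
  · rw [indicator_of_notMem hx, indicator_of_notMem hy, dist_self]
    positivity

theorem bijOn_id_add_of_lipschitzOnWith [CompleteSpace E] {s : Set E} {K : ℝ≥0} {g : E → E}
    (hg : LipschitzOnWith K g (closure s)) (hK : K < 1) (h0 : EqOn g 0 (frontier s)) :
    BijOn (fun x => x + g x) s s := by
  set f : E → E := fun x => x + s.indicator g x with hf
  have hbij : Function.Bijective f :=
    bijective_id_add_of_lipschitzWith (lipschitzWith_indicator hg h0) hK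
  have hout {x : E} (hx : x ∉ s) : f x = x := by simp [hf, hx]
  refine BijOn.congr (f₁ := f) ⟨fun x hx => ?_, hbij.injective.injOn, fun y hy => ?_⟩
    fun x hx => by simp [hf, hx]
  · by_contra hfx
    exact hfx ((hbij.injective (hout hfx)).symm ▸ hx)
  · obtain ⟨x, rfl⟩ := hbij.surjective y
    refine ⟨x, ?_, rfl⟩
    by_contra hx
    exact hx (hout hx ▸ hy)

section Determinant

variable [FiniteDimensional ℝ E]

theorem det_one_add_pos {B : E →L[ℝ] E} (hB : ‖B‖ < 1) : 0 < (1 + B).det := by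
  have hne : ∀ s ∈ Icc (0 : ℝ) 1, (1 + s • B).det ≠ 0 := fun s hs => by
    have hlt : ‖-(s • B)‖ < 1 := by
      rw [norm_neg, norm_smul, Real.norm_of_nonneg hs.1]
      exact (mul_le_of_le_one_left (norm_nonneg B) hs.2).trans_lt hB
    have hunit := (isUnit_one_sub_of_norm_lt_one hlt).map ContinuousLinearMap.toLinearMapRingHom
    rw [sub_neg_eq_add] at hunit
    exact (hunit.map LinearMap.det).ne_zero
  have hcont : Continuous fun s : ℝ => (1 + s • B).det :=
    ContinuousLinearMap.continuous_det.comp (by fun_prop)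
  have h0 : (1 + (0 : ℝ) • B).det = 1 := by simp [ContinuousLinearMap.det]
  by_contra! hle
  obtain ⟨s, hs, hs0⟩ := intermediate_value_Icc' (zero_le_one' ℝ) hcont.continuousOn
    (show (0 : ℝ) ∈ Icc _ _ from ⟨by simpa using hle, h0 ▸ zero_le_one⟩)
  exact hne s hs hs0

theorem exists_polynomial_eval_eq_det_one_add_smul (A : E →L[ℝ] E) :
    ∃ p : ℝ[X], p.natDegree ≤ Module.finrank ℝ E ∧ ∀ s, p.eval s = (1 + s • A).det := by
  let b := Module.finBasis ℝ E
  let M := LinearMap.toMatrix b b A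
  refine ⟨((Polynomial.X : ℝ[X]) • M.map Polynomial.C + (1 : Matrix _ _ ℝ).map Polynomial.C).det,
    ?_, fun s => ?_⟩
  · simpa using Polynomial.natDegree_det_X_add_C_le M 1
  · have hmat : LinearMap.toMatrix b b (1 + s • A : E →L[ℝ] E) = 1 + s • M := by
      rw [← LinearMap.toMatrix_one b, ← map_smul, ← map_add]
      rfl
    rw [ContinuousLinearMap.det, ← LinearMap.det_toMatrix b, hmat, ← Polynomial.coe_evalRingHom,
      RingHom.map_det]
    congr 1
    ext i j
    by_cases hij : i = j <;> simp [hij] <;> ring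

theorem eval_eq_sum_eval_mul_eval_lagrangeBasis {F : Type*} [Field F] [DecidableEq F] {p : F[X]}
    {s : Finset F} (hp : p.degree < s.card) (x : F) :
    p.eval x = ∑ i ∈ s, p.eval i * (Lagrange.basis s id i).eval x := by
  conv_lhs => rw [Lagrange.eq_interpolate (v := id) (injOn_id _) hp]
  simp [Lagrange.interpolate_apply, Polynomial.eval_finsetSum]

theorem exists_weights_det_one_add {N : Finset ℝ} (hN : Module.finrank ℝ E < N.card) :
    ∃ c : ℝ → ℝ, ∀ A : E →L[ℝ] E, (1 + A).det = ∑ t ∈ N, (1 + t • A).det * c t := by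
  refine ⟨fun t => (Lagrange.basis N id t).eval 1, fun A => ?_⟩
  obtain ⟨p, hp, hpA⟩ := exists_polynomial_eval_eq_det_one_add_smul A
  have hdeg : p.degree < N.card :=
    Polynomial.degree_le_natDegree.trans_lt (by exact_mod_cast hp.trans_lt hN)
  simpa only [hpA, one_smul] using eval_eq_sum_eval_mul_eval_lagrangeBasis hdeg 1

end Determinant

section Integral

variable [FiniteDimensional ℝ E] [MeasurableSpace E] [BorelSpace E] {s : Set E} {g : E → E}

theorem setIntegral_det_one_add_fderiv_of_lipschitzOnWith (μ : Measure E) [μ.IsAddHaarMeasure]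
    (hs : IsOpen s) (hg : ∀ x ∈ s, DifferentiableAt ℝ g x) {K : ℝ≥0}
    (hK : LipschitzOnWith K g (closure s)) (hK1 : K < 1) (h0 : EqOn g 0 (frontier s)) :
    ∫ x in s, (1 + fderiv ℝ g x).det ∂μ = μ.real s := by
  have hbij := bijOn_id_add_of_lipschitzOnWith hK hK1 h0
  have himage := integral_image_eq_integral_abs_det_fderiv_smul μ hs.measurableSet
    (f := fun x => x + g x) (f' := fun x => 1 + fderiv ℝ g x)
    (fun x hx => ((hasFDerivAt_id x).add (hg x hx).hasFDerivAt).hasFDerivWithinAt) hbij.injOn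
    (fun _ => (1 : ℝ))
  rw [hbij.image_eq, setIntegral_one_eq_measureReal] at himage
  rw [himage]
  refine setIntegral_congr_fun hs.measurableSet fun x hx => ?_
  have hlt : ‖fderiv ℝ g x‖ < 1 :=
    ((hg x hx).hasFDerivAt.le_of_lipschitzOn (mem_of_superset (hs.mem_nhds hx) subset_closure)
      hK).trans_lt hK1
  simp only [smul_eq_mul, mul_one, abs_of_pos (det_one_add_pos hlt)]

theorem setIntegral_det_one_add_smul_fderiv (μ : Measure E) [μ.IsAddHaarMeasure]
    (hs : IsOpen s) (hg : ∀ x ∈ s, DifferentiableAt ℝ g x) {K : ℝ≥0}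
    (hK : LipschitzOnWith K g (closure s)) (h0 : EqOn g 0 (frontier s)) {t : ℝ} (ht : 0 ≤ t)
    (htK : t * K < 1) : ∫ x in s, (1 + t • fderiv ℝ g x).det ∂μ = μ.real s := by
  lift t to ℝ≥0 using ht
  have hlip : LipschitzOnWith (t * K) ((t : ℝ) • g) (closure s) :=
    LipschitzOnWith.of_dist_le_mul fun x hx y hy => by
      rw [Pi.smul_apply, Pi.smul_apply, dist_smul₀, Real.norm_of_nonneg t.coe_nonneg,
        NNReal.coe_mul, mul_assoc]
      exact mul_le_mul_of_nonneg_left (hK.dist_le_mul x hx y hy) t.coe_nonneg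
  rw [← setIntegral_det_one_add_fderiv_of_lipschitzOnWith μ hs
    (fun x hx => (hg x hx).const_smul (t : ℝ)) hlip (by exact_mod_cast htK)
    fun x hx => by simp [h0 hx]]
  exact setIntegral_congr_fun hs.measurableSet fun x hx => by
    simp only [fderiv_const_smul (hg x hx)]

-- The integral for `t • g` is a polynomial in `t`, and it is constant for small `t`.
theorem setIntegral_det_one_add_fderiv (μ : Measure E) [μ.IsAddHaarMeasure]
    (hs : IsOpen s) (hconv : Convex ℝ s) (hbdd : Bornology.IsBounded s) (hg : ContDiff ℝ 1 g)
    (h0 : EqOn g 0 (frontier s)) : ∫ x in s, (1 + fderiv ℝ g x).det ∂μ = μ.real s := by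
  obtain ⟨K, hK⟩ := hg.contDiffOn.exists_lipschitzOnWith one_ne_zero hconv.closure
    hbdd.isCompact_closure
  have hint (t : ℝ) : IntegrableOn (fun x => (1 + t • fderiv ℝ g x).det) s μ :=
    ((ContinuousLinearMap.continuous_det.comp
      (continuous_const.add ((hg.continuous_fderiv one_ne_zero).const_smul t))).continuousOn
        |>.integrableOn_compact hbdd.isCompact_closure).mono_set subset_closure
  have hsmall {t : ℝ} (ht : t ∈ Ico 0 (1 / (K + 1 : ℝ))) :
      ∫ x in s, (1 + t • fderiv ℝ g x).det ∂μ = μ.real s :=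
    setIntegral_det_one_add_smul_fderiv μ hs (fun x _ => hg.differentiable one_ne_zero x) hK h0
      ht.1 (by linarith [ht.1, (lt_div_iff₀ (by positivity)).1 ht.2])
  obtain ⟨N, hN, hNcard⟩ := (Ico_infinite (show (0 : ℝ) < 1 / (K + 1) by positivity)
    ).exists_subset_card_eq (Module.finrank ℝ E + 1)
  obtain ⟨c, hdet⟩ := exists_weights_det_one_add (E := E) (N := N) (by omega)
  have hsum : ∑ t ∈ N, c t = 1 := by simpa [ContinuousLinearMap.det] using (hdet 0).symm
  calc ∫ x in s, (1 + fderiv ℝ g x).det ∂μ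
      = ∫ x in s, ∑ t ∈ N, (1 + t • fderiv ℝ g x).det * c t ∂μ :=
        integral_congr_ae (ae_of_all _ fun x => hdet _)
    _ = ∑ t ∈ N, (∫ x in s, (1 + t • fderiv ℝ g x).det ∂μ) * c t := by
        rw [integral_finsetSum _ fun t _ => (hint t).mul_const (c t)]
        simp_rw [integral_mul_const]
    _ = ∑ t ∈ N, μ.real s * c t :=
        Finset.sum_congr rfl fun t ht => by rw [hsmall (hN ht)]
    _ = μ.real s := by rw [← Finset.mul_sum, hsum, mul_one]

end Integral

section Retraction

variable {E : Type*} [NormedAddCommGroup E] [InnerProductSpace ℝ E]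

theorem inner_fderiv_eq_zero_of_norm_eq {F : Type*} [NormedAddCommGroup F] [NormedSpace ℝ F]
    {r : F → E} {x : F} {R : ℝ} (hr : DifferentiableAt ℝ r x) (hnorm : ∀ y, ‖r y‖ = R) (u : F) :
    inner ℝ (r x) (fderiv ℝ r x u) = 0 := by
  have hconst : (fun y => ‖r y‖ ^ 2) = fun _ => R ^ 2 := funext fun y => by rw [hnorm]
  have hderiv := hr.hasFDerivAt.norm_sq
  rw [hconst] at hderiv
  simpa using congr($(hderiv.unique (hasFDerivAt_const _ x)) u)

variable [FiniteDimensional ℝ E]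

theorem det_fderiv_eq_zero_of_norm_eq {r : E → E} {x : E} {R : ℝ} (hR : R ≠ 0)
    (hr : DifferentiableAt ℝ r x) (hnorm : ∀ y, ‖r y‖ = R) : (fderiv ℝ r x).det = 0 := by
  by_contra hdet
  let e := (fderiv ℝ r x).toContinuousLinearEquivOfDetNeZero hdet
  have horth := inner_fderiv_eq_zero_of_norm_eq hr hnorm (e.symm (r x))
  have hsymm : fderiv ℝ r x (e.symm (r x)) = r x := e.apply_symm_apply (r x)
  rw [hsymm, real_inner_self_eq_norm_sq, hnorm] at horth
  exact hR (pow_eq_zero_iff two_ne_zero |>.1 horth)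

theorem not_contDiff_retraction_sphere {R : ℝ} (hR : 0 < R) {r : E → E} (hr : ContDiff ℝ 1 r)
    (hnorm : ∀ x, ‖r x‖ = R) : ∃ x ∈ sphere 0 R, r x ≠ x := by
  borelize E
  by_contra! hid
  have hzero : EqOn (fun x => r x - x) 0 (frontier (ball 0 R)) := fun x hx => by
    rw [frontier_ball _ hR.ne'] at hx
    exact sub_eq_zero.2 (hid x hx)
  have hdet (x : E) : (1 + fderiv ℝ (fun x => r x - x) x).det = 0 := by
    have hrx := hr.differentiable one_ne_zero x
    rw [fderiv_fun_sub hrx differentiableAt_fun_id, fderiv_fun_id, ← ContinuousLinearMap.one_def,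
      add_sub_cancel]
    exact det_fderiv_eq_zero_of_norm_eq hR.ne' hrx hnorm
  have hvol := setIntegral_det_one_add_fderiv (g := fun x => r x - x) volume isOpen_ball
    (convex_ball 0 R) isBounded_ball (hr.sub contDiff_id) hzero
  simp_rw [hdet, integral_zero] at hvol
  exact (ENNReal.toReal_pos (measure_ball_pos _ _ hR).ne' measure_ball_lt_top.ne).ne hvol

theorem exists_fixedPoint_of_hasCompactSupport {f : E → E} (hf : Continuous f)
    (hsupp : HasCompactSupport f) : ∃ x, f x = x := by
  by_contra! hne
  obtain ⟨w, hw, hdist, hws⟩ := hf.exists_contDiff_approx 1 (continuous_id.sub hf).norm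
    fun x => norm_pos_iff.2 (sub_ne_zero.2 (hne x).symm)
  have hw_ne (x : E) : x - w x ≠ 0 := fun hx => by
    have := hdist x
    rw [← sub_eq_zero.1 hx, dist_eq_norm] at this
    exact lt_irrefl _ this
  obtain ⟨R, hR, hRf⟩ := hsupp.isCompact.isBounded.subset_ball_lt 0 0
  have hw0 {x : E} (hx : ‖x‖ = R) : w x = 0 := by
    by_contra h
    simpa [hx] using hRf (subset_closure (hws h))
  have hu : ContDiff ℝ 1 fun x => x - w x := contDiff_id.sub hw
  obtain ⟨x, hx, hrx⟩ := not_contDiff_retraction_sphere hR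
    (r := fun x => (R * ‖x - w x‖⁻¹) • (x - w x))
    ((contDiff_const.mul ((hu.norm ℝ hw_ne).inv fun x => norm_ne_zero_iff.2 (hw_ne x))).smul hu)
    fun x => by
      rw [norm_smul, norm_mul, norm_inv, norm_norm, Real.norm_of_nonneg hR.le, mul_assoc,
        inv_mul_cancel₀ (norm_ne_zero_iff.2 (hw_ne x)), mul_one]
  rw [mem_sphere_zero_iff_norm] at hx
  exact hrx (by rw [hw0 hx, sub_zero, hx, mul_inv_cancel₀ hR.ne', one_smul])

end Retraction

/-- **Brouwer's fixed point theorem** for maps with relatively compact range. -/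
theorem exists_fixedPoint_of_forall_mem_isCompact {X : Type*} [AddCommGroup X] [Module ℝ X]
    [TopologicalSpace X] [IsTopologicalAddGroup X] [ContinuousSMul ℝ X] [T2Space X]
    [FiniteDimensional ℝ X] {f : X → X} (hf : Continuous f) {K : Set X} (hK : IsCompact K)
    (hfK : ∀ x, f x ∈ K) : ∃ x, f x = x := by
  let e : X ≃L[ℝ] EuclideanSpace ℝ (Fin (Module.finrank ℝ X)) := toEuclidean
  obtain ⟨R, hR, hKR⟩ := (hK.image e.continuous).isBounded.subset_ball_lt 0 0
  let χ : ContDiffBump (0 : EuclideanSpace ℝ (Fin (Module.finrank ℝ X))) :=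
    ⟨R, R + 1, hR, lt_add_one R⟩
  obtain ⟨y, hy⟩ := exists_fixedPoint_of_hasCompactSupport
    (f := fun y => χ y • e (f (e.symm y)))
    (χ.continuous.smul (by fun_prop)) χ.hasCompactSupport.smul_right
  have hyR : ‖y‖ ≤ R := by
    have hball : ‖e (f (e.symm y))‖ < R := by simpa using hKR (mem_image_of_mem e (hfK _))
    rw [← hy, norm_smul, Real.norm_of_nonneg χ.nonneg]
    exact (mul_le_of_le_one_left (norm_nonneg _) χ.le_one).trans hball.le
  rw [χ.one_of_mem_closedBall (by simpa using hyR), one_smul] at hy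
  exact ⟨e.symm y, (e.eq_symm_apply).2 hy⟩

end Brouwer

section Radau

open Polynomial

/-- The coefficients of the hypergeometric polynomial `₂F₁(-N, N; 1; X)`. -/
noncomputable def radauCoeff (N : ℕ) : ℕ → ℝ
  | 0 => 1
  | j + 1 => radauCoeff N j * ((j : ℝ) ^ 2 - (N : ℝ) ^ 2) / ((j : ℝ) + 1) ^ 2

/-- The Radau polynomial of degree `N` on `[0, 1]`, normalized to be `1` at `0`: for `N ≠ 0` it
vanishes at `1`. Its derivative represents, in `L²(0, 1)`, the functional `q ↦ -q(0)` on the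
polynomials of degree less than `N`. -/
noncomputable def radau (N : ℕ) : ℝ[X] := ∑ j ∈ Finset.range (N + 1), C (radauCoeff N j) * X ^ j

theorem radauCoeff_eq_zero_of_lt {N j : ℕ} (hj : N < j) : radauCoeff N j = 0 := by
  induction j, hj using Nat.le_induction with
  | base => simp [radauCoeff]
  | succ j _ ih => simp [radauCoeff, ih]

theorem radauCoeff_ne_zero {N j : ℕ} (hj : j ≤ N) : radauCoeff N j ≠ 0 := by
  induction j with
  | zero => exact one_ne_zero
  | succ j ih =>
    have hlt : (j : ℝ) ^ 2 < (N : ℝ) ^ 2 := by gcongr; omega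
    exact div_ne_zero (mul_ne_zero (ih (by omega)) (sub_ne_zero.2 hlt.ne)) (by positivity)

theorem coeff_radau (N j : ℕ) : (radau N).coeff j = radauCoeff N j := by
  simp only [radau, finsetSum_coeff, coeff_C_mul_X_pow]
  rcases lt_or_ge N j with h | h
  · rw [radauCoeff_eq_zero_of_lt h]
    exact Finset.sum_eq_zero fun i hi => if_neg (by have := Finset.mem_range.1 hi; omega)
  · rw [Finset.sum_ite_eq, if_pos (Finset.mem_range.2 (by omega))]

theorem radau_ode (N : ℕ) :
    (1 - X) * (derivative (radau N) + X * derivative (derivative (radau N))) =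
      -((N : ℝ[X]) ^ 2 * radau N) := by
  have hcoeff (n : ℕ) : (derivative (X * derivative (radau N))).coeff n =
      ((n : ℝ) ^ 2 - (N : ℝ) ^ 2) * radauCoeff N n := by
    rw [coeff_derivative, coeff_X_mul, coeff_derivative, coeff_radau, radauCoeff]
    field_simp
  have hderiv : derivative (radau N) + X * derivative (derivative (radau N)) =
      derivative (X * derivative (radau N)) := by
    rw [derivative_mul, derivative_X, one_mul]
  rw [hderiv]
  ext n
  rw [sub_mul, one_mul, coeff_sub, coeff_neg, ← Nat.cast_pow, coeff_natCast_mul, coeff_radau,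
    hcoeff]
  cases n with
  | zero => simp
  | succ n =>
    rw [coeff_X_mul, hcoeff, radauCoeff]
    push_cast
    field_simp
    ring

theorem eval_zero_radau (N : ℕ) : (radau N).eval 0 = 1 := by
  rw [← coeff_zero_eq_eval_zero, coeff_radau, radauCoeff]

theorem eval_one_radau {N : ℕ} (hN : N ≠ 0) : (radau N).eval 1 = 0 := by
  simpa [hN] using congrArg (eval 1) (radau_ode N)

-- The Sonin function `S` of the differential equation decreases on `[0, 1]` from `S(0) = N²`,
-- and it dominates `N² ρ²`.
theorem abs_eval_radau_le_one {N : ℕ} (hN : N ≠ 0) {s : ℝ} (hs : s ∈ Icc (0 : ℝ) 1) :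
    |(radau N).eval s| ≤ 1 := by
  let S : ℝ[X] := (N : ℝ[X]) ^ 2 * radau N ^ 2 + X * (1 - X) * derivative (radau N) ^ 2
  have hS : derivative S = -(derivative (radau N) ^ 2) := by
    simp only [S, derivative_add, derivative_mul, derivative_natCast, derivative_pow, derivative_X,
      derivative_sub, derivative_one, Nat.cast_ofNat, map_ofNat]
    linear_combination (2 * derivative (radau N)) * radau_ode N
  have hanti : AntitoneOn (fun x => S.eval x) (Icc 0 1) :=
    antitoneOn_of_deriv_nonpos (convex_Icc 0 1) S.continuous.continuousOn
      S.differentiable.differentiableOn fun x _ => by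
        rw [Polynomial.deriv, hS, eval_neg, eval_pow]
        exact neg_nonpos.2 (sq_nonneg _)
  have hle := hanti ⟨le_rfl, zero_le_one⟩ hs hs.1
  simp only [S, eval_add, eval_mul, eval_natCast, eval_pow, eval_X, eval_sub, eval_one,
    eval_zero_radau] at hle
  have hnonneg : 0 ≤ s * (1 - s) * eval s (derivative (radau N)) ^ 2 :=
    mul_nonneg (mul_nonneg hs.1 (sub_nonneg.2 hs.2)) (sq_nonneg _)
  have hN2 : (0 : ℝ) < (N : ℝ) ^ 2 := by positivity
  exact (sq_le_one_iff_abs_le_one _).1 (le_of_mul_le_mul_left (by linarith) hN2)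

theorem integral_eval_derivative (p : ℝ[X]) (a b : ℝ) :
    ∫ s in a..b, (derivative p).eval s = p.eval b - p.eval a :=
  intervalIntegral.integral_eq_sub_of_hasDerivAt (fun x _ => p.hasDerivAt x)
    ((derivative p).continuous.intervalIntegrable _ _)

-- Integrating the derivative of `Φ`, which vanishes at both end points, relates the moments of
-- order `j` and `j + 1`.
theorem integral_derivative_radau_mul_pow_succ {N : ℕ} (hN : N ≠ 0) (j : ℕ) :
    (((N : ℝ) ^ 2 - ((j : ℝ) + 1) ^ 2) *
      ∫ s in (0 : ℝ)..1, (derivative (radau N)).eval s * s ^ (j + 1)) =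
      -((((j : ℝ) + 1) * j) * ∫ s in (0 : ℝ)..1, (derivative (radau N)).eval s * s ^ j) := by
  let Φ : ℝ[X] := ((j : ℝ[X]) + 1) * ((1 - X) * X ^ (j + 1) * derivative (radau N)) +
    (N : ℝ[X]) ^ 2 * (radau N * X ^ (j + 1))
  have hΦ : derivative Φ = (((j : ℝ[X]) + 1) * (j : ℝ[X])) * (derivative (radau N) * X ^ j) +
      ((N : ℝ[X]) ^ 2 - ((j : ℝ[X]) + 1) ^ 2) * (derivative (radau N) * X ^ (j + 1)) := by
    simp only [Φ, derivative_mul, derivative_natCast, derivative_pow, derivative_X,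
      derivative_sub, derivative_one, map_add, map_one, map_natCast, Nat.cast_add, Nat.cast_one,
      Nat.add_sub_cancel]
    linear_combination (((j : ℝ[X]) + 1) * X ^ j) * radau_ode N
  have hend : Φ.eval 1 - Φ.eval 0 = 0 := by simp [Φ, eval_one_radau hN]
  have hint := integral_eval_derivative Φ 0 1
  simp only [hend, hΦ, eval_add, eval_mul, eval_sub, eval_pow, eval_X, eval_natCast,
    eval_one] at hint
  rw [intervalIntegral.integral_add (Continuous.intervalIntegrable (by fun_prop) _ _)
      (Continuous.intervalIntegrable (by fun_prop) _ _),
    intervalIntegral.integral_const_mul, intervalIntegral.integral_const_mul] at hint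
  linarith

theorem integral_derivative_radau_mul_pow {N j : ℕ} (hj : j < N) :
    ∫ s in (0 : ℝ)..1, (derivative (radau N)).eval s * s ^ j = -(0 ^ j) := by
  have hN : N ≠ 0 := by omega
  induction j with
  | zero =>
    simp only [pow_zero, mul_one]
    rw [integral_eval_derivative, eval_zero_radau, eval_one_radau hN, zero_sub]
  | succ j ih =>
    have hzero : (((j : ℝ) + 1) * j) * -(0 ^ j) = 0 := by cases j <;> simp
    have hlt : ((j : ℝ) + 1) ^ 2 < (N : ℝ) ^ 2 := by gcongr; exact_mod_cast hj
    have hrec := integral_derivative_radau_mul_pow_succ hN j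
    rw [ih (by omega), hzero, neg_zero] at hrec
    simpa using (mul_eq_zero.1 hrec).resolve_left (sub_ne_zero.2 hlt.ne')

theorem integral_derivative_radau_mul {N : ℕ} {q : ℝ[X]} (hq : q.natDegree < N) :
    ∫ s in (0 : ℝ)..1, (derivative (radau N)).eval s * q.eval s = -q.eval 0 := by
  simp_rw [eval_eq_sum_range' hq, Finset.mul_sum, mul_left_comm _ (q.coeff _)]
  rw [intervalIntegral.integral_finsetSum fun i _ =>
    Continuous.intervalIntegrable (by fun_prop) _ _, ← Finset.sum_neg_distrib]
  refine Finset.sum_congr rfl fun i hi => ?_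
  rw [intervalIntegral.integral_const_mul,
    integral_derivative_radau_mul_pow (Finset.mem_range.1 hi), mul_neg]

end Radau

section VectorPolynomials

variable {E : Type*} [NormedAddCommGroup E] [NormedSpace ℝ E]

/-- The polynomial function `t ↦ ∑ i ≤ r, tⁱ xᵢ`, as a linear map of its coefficients. -/
def polyMap (r : ℕ) : (Fin (r + 1) → E) →ₗ[ℝ] C(ℝ, E) where
  toFun x := ⟨fun t => ∑ i : Fin (r + 1), t ^ (i : ℕ) • x i, by fun_prop⟩
  map_add' x y := by ext t; simp [Finset.sum_add_distrib]
  map_smul' c x := by ext t; simp [Finset.smul_sum, smul_comm c]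

variable (E) in
/-- The space of polynomial functions of degree at most `r` on `ℝ` with coefficients in `E`. -/
def polySubmodule (r : ℕ) : Submodule ℝ C(ℝ, E) := (polyMap r).range

theorem polyMap_apply {r : ℕ} (x : Fin (r + 1) → E) (t : ℝ) :
    polyMap r x t = ∑ i : Fin (r + 1), t ^ (i : ℕ) • x i := rfl

theorem polyMap_mem {r : ℕ} (x : Fin (r + 1) → E) : polyMap r x ∈ polySubmodule E r := ⟨x, rfl⟩

theorem differentiable_of_mem_polySubmodule {r : ℕ} {f : C(ℝ, E)} (hf : f ∈ polySubmodule E r) :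
    Differentiable ℝ f := by
  obtain ⟨x, rfl⟩ := hf
  change Differentiable ℝ fun t : ℝ => ∑ i : Fin (r + 1), t ^ (i : ℕ) • x i
  fun_prop

theorem mem_polySubmodule_of_eval_smul {r : ℕ} {p : Polynomial ℝ} (hp : p.natDegree ≤ r) {v : E}
    {f : C(ℝ, E)} (hf : ∀ t, f t = p.eval t • v) : f ∈ polySubmodule E r := by
  refine ⟨fun i => p.coeff i • v, ContinuousMap.ext fun t => ?_⟩
  rw [polyMap_apply, hf, Polynomial.eval_eq_sum_range' (Nat.lt_succ_of_le hp), Finset.sum_smul,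
    ← Fin.sum_univ_eq_sum_range (fun i => (p.coeff i * t ^ i) • v)]
  exact Finset.sum_congr rfl fun i _ => by rw [smul_smul, mul_comm]

theorem mem_polySubmodule_of_sum_eval_smul {ι : Type*} [Fintype ι] {r : ℕ} {p : ι → Polynomial ℝ}
    (hp : ∀ i, (p i).natDegree ≤ r) {v : ι → E} {f : C(ℝ, E)}
    (hf : ∀ t, f t = ∑ i, (p i).eval t • v i) : f ∈ polySubmodule E r := by
  have hsum : f = ∑ i, (p i).toContinuousMap • ContinuousMap.const ℝ (v i) := by
    ext t
    simp [hf]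
  rw [hsum]
  exact sum_mem fun i _ => mem_polySubmodule_of_eval_smul (hp i) fun t => rfl

theorem const_mem_polySubmodule (r : ℕ) (v : E) : ContinuousMap.const ℝ v ∈ polySubmodule E r :=
  mem_polySubmodule_of_eval_smul (p := 1) (v := v) (by simp) fun t => by simp

theorem comp_affine_mem_polySubmodule {r : ℕ} {f : C(ℝ, E)} (hf : f ∈ polySubmodule E r)
    (α β : ℝ) : f.comp ⟨fun t => α + β * t, by fun_prop⟩ ∈ polySubmodule E r := by
  obtain ⟨x, rfl⟩ := hf
  refine mem_polySubmodule_of_sum_eval_smul (ι := Fin (r + 1))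
    (p := fun i => (Polynomial.C α + Polynomial.C β * Polynomial.X) ^ (i : ℕ)) (v := x)
    (fun i => ?_) fun t => by simp [polyMap_apply]
  have hle : (Polynomial.C α + Polynomial.C β * Polynomial.X).natDegree ≤ 1 := by compute_degree
  exact Polynomial.natDegree_pow_le_of_le (i : ℕ) hle |>.trans (by omega)

/-- The primitive of a continuous function that vanishes at `0`. -/
noncomputable def primitive : C(ℝ, E) →ₗ[ℝ] C(ℝ, E) where
  toFun f := ⟨fun t => ∫ s in 0..t, f s,
    intervalIntegral.continuous_primitive (fun a b => f.continuous.intervalIntegrable a b) 0⟩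
  map_add' f g := ContinuousMap.ext fun t => intervalIntegral.integral_add
    (f.continuous.intervalIntegrable 0 t) (g.continuous.intervalIntegrable 0 t)
  map_smul' c f := ContinuousMap.ext fun _ => intervalIntegral.integral_smul c f

theorem primitive_apply (f : C(ℝ, E)) (t : ℝ) : primitive f t = ∫ s in 0..t, f s := rfl

theorem primitive_zero (f : C(ℝ, E)) : primitive f 0 = 0 := intervalIntegral.integral_same

theorem hasDerivAt_primitive [CompleteSpace E] (f : C(ℝ, E)) (t : ℝ) :
    HasDerivAt (primitive f) (f t) t :=
  (f.continuous.integral_hasStrictDerivAt 0 t).hasDerivAt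

theorem primitive_polyMap_apply [CompleteSpace E] {r : ℕ} (x : Fin (r + 1) → E) (t : ℝ) :
    primitive (polyMap r x) t = ∑ i : Fin (r + 1), t ^ (i + 1 : ℕ) • ((i : ℝ) + 1)⁻¹ • x i := by
  simp_rw [primitive_apply, polyMap_apply]
  rw [intervalIntegral.integral_finsetSum fun i _ =>
    Continuous.intervalIntegrable (by fun_prop) _ _]
  refine Finset.sum_congr rfl fun i _ => ?_
  rw [intervalIntegral.integral_smul_const, integral_pow, smul_smul]
  simp [div_eq_mul_inv]

theorem primitive_polyMap_mem [CompleteSpace E] {r : ℕ} (x : Fin (r + 1) → E) :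
    primitive (polyMap r x) ∈ polySubmodule E (r + 1) :=
  mem_polySubmodule_of_sum_eval_smul (p := fun i : Fin (r + 1) => Polynomial.X ^ (i + 1 : ℕ))
    (v := fun i => ((i : ℝ) + 1)⁻¹ • x i)
    (fun i => by rw [Polynomial.natDegree_X_pow]; omega)
    fun t => by simp [primitive_polyMap_apply]

end VectorPolynomials

section L2

variable {E : Type*} [NormedAddCommGroup E] [InnerProductSpace ℝ E]

/-- The class in `L²(0, 1)` of a continuous function on `ℝ`. -/
noncomputable def toL2 : C(ℝ, E) →L[ℝ] Lp E 2 (volume : Measure unitInterval) :=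
  (ContinuousMap.toLp 2 volume ℝ).comp
    (ContinuousMap.compCLM ℝ E ⟨Subtype.val, continuous_subtype_val⟩)

theorem inner_toL2 (u v : C(ℝ, E)) :
    inner ℝ (toL2 u) (toL2 v) = ∫ s in (0 : ℝ)..1, inner ℝ (u s) (v s) := by
  have hcoe (w : C(ℝ, E)) : toL2 w =ᵐ[volume] fun s : unitInterval => w s :=
    ContinuousMap.coeFn_toLp volume _
  rw [L2.inner_def, intervalIntegral.integral_of_le zero_le_one, ← integral_Icc_eq_integral_Ioc,
    ← integral_subtype_comap measurableSet_Icc, ← unitInterval.volume_def]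
  refine integral_congr_ae ?_
  filter_upwards [hcoe u, hcoe v] with s hu hv
  rw [hu, hv]

theorem norm_toL2_sq (u : C(ℝ, E)) : ‖toL2 u‖ ^ 2 = ∫ s in (0 : ℝ)..1, ‖u s‖ ^ 2 := by
  simp_rw [← real_inner_self_eq_norm_sq, inner_toL2]

theorem norm_toL2_le {u : C(ℝ, E)} {m : ℝ} (hm : ∀ s ∈ Icc (0 : ℝ) 1, ‖u s‖ ≤ m) :
    ‖toL2 u‖ ≤ m := by
  have hm0 : 0 ≤ m := (norm_nonneg _).trans (hm 0 (by simp))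
  refine (sq_le_sq₀ (norm_nonneg _) hm0).1 ?_
  calc ‖toL2 u‖ ^ 2 = ∫ s in (0 : ℝ)..1, ‖u s‖ ^ 2 := norm_toL2_sq u
    _ ≤ ∫ _ in (0 : ℝ)..1, m ^ 2 :=
      intervalIntegral.integral_mono_on zero_le_one
        (Continuous.intervalIntegrable (by fun_prop) _ _) intervalIntegrable_const
        fun s hs => by gcongr; exact hm s hs
    _ = m ^ 2 := by simp

theorem integral_norm_le_norm_toL2 (u : C(ℝ, E)) : ∫ s in (0 : ℝ)..1, ‖u s‖ ≤ ‖toL2 u‖ := by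
  let v : C(ℝ, ℝ) := ⟨fun s => ‖u s‖, by fun_prop⟩
  have hv : ‖toL2 v‖ = ‖toL2 u‖ := by
    rw [← sq_eq_sq₀ (norm_nonneg _) (norm_nonneg _), norm_toL2_sq, norm_toL2_sq]
    simp [v]
  calc ∫ s in (0 : ℝ)..1, ‖u s‖ = inner ℝ (toL2 v) (toL2 (ContinuousMap.const ℝ (1 : ℝ))) := by
        simp [inner_toL2, v]
    _ ≤ ‖toL2 v‖ * ‖toL2 (ContinuousMap.const ℝ (1 : ℝ))‖ := real_inner_le_norm _ _
    _ ≤ ‖toL2 v‖ * 1 := by gcongr; exact norm_toL2_le fun s _ => by simp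
    _ = ‖toL2 u‖ := by rw [mul_one, hv]

theorem norm_primitive_le_norm_toL2 (u : C(ℝ, E)) {s : ℝ} (hs : s ∈ Icc (0 : ℝ) 1) :
    ‖primitive u s‖ ≤ ‖toL2 u‖ :=
  calc ‖primitive u s‖ ≤ ∫ σ in (0 : ℝ)..s, ‖u σ‖ :=
        intervalIntegral.norm_integral_le_integral_norm hs.1
    _ ≤ ∫ σ in (0 : ℝ)..1, ‖u σ‖ :=
        intervalIntegral.integral_mono_interval le_rfl hs.1 hs.2
          (ae_of_all _ fun _ => norm_nonneg _) (Continuous.intervalIntegrable (by fun_prop) _ _)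
    _ ≤ ‖toL2 u‖ := integral_norm_le_norm_toL2 u

end L2

section Galerkin

theorem exists_inner_galerkin {X : Type*} [AddCommGroup X] [Module ℝ X] [TopologicalSpace X]
    [IsTopologicalAddGroup X] [ContinuousSMul ℝ X] [T2Space X] [FiniteDimensional ℝ X]
    {Y : Type*} [NormedAddCommGroup Y] [InnerProductSpace ℝ Y] (D : X →ₗ[ℝ] Y) {N : X → Y}
    (hN : Continuous N) {m : ℝ} (hm : ∀ x, ‖N x‖ ≤ m) :
    ∃ x, ‖D x‖ ≤ m ∧ ∀ y, inner ℝ (D x) (D y) = inner ℝ (N x) (D y) := by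
  obtain ⟨σ, hσ⟩ := D.rangeRestrict.exists_rightInverse_of_surjective D.range_rangeRestrict
  let P : X → D.range := fun x => D.range.orthogonalProjectionOnto (N x)
  have hP (x : X) : ‖P x‖ ≤ m := (D.range.norm_orthogonalProjectionOnto_apply_le _).trans (hm x)
  have hσc : Continuous σ := σ.continuous_of_finiteDimensional
  obtain ⟨x, hx⟩ := exists_fixedPoint_of_forall_mem_isCompact (f := fun x => σ (P x))
    (hσc.comp (by fun_prop)) ((isCompact_closedBall (0 : D.range) m).image hσc)
    fun x => mem_image_of_mem σ (by simpa using hP x)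
  have hDx : D x = P x := by
    conv_lhs => rw [← hx]
    exact congr(($hσ (P x) : Y))
  refine ⟨x, hDx ▸ hP x, fun y => ?_⟩
  rw [hDx]
  exact D.range.inner_orthogonalProjectionOnto_eq_of_mem_right ⟨D y, y, rfl⟩ (N x)

variable {E : Type*} [NormedAddCommGroup E] [InnerProductSpace ℝ E]

theorem exists_integral_galerkin {X : Type*} [AddCommGroup X] [Module ℝ X] [TopologicalSpace X]
    [IsTopologicalAddGroup X] [ContinuousSMul ℝ X] [T2Space X] [FiniteDimensional ℝ X]
    (Z S : X →ₗ[ℝ] C(ℝ, E)) (g : C(ℝ × E, E)) {m : ℝ} (hm : ∀ p, ‖g p‖ ≤ m) :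
    ∃ x, ‖toL2 (Z x)‖ ≤ m ∧ ∀ y, ∫ s in (0 : ℝ)..1, inner ℝ (Z x s) (Z y s) =
      ∫ s in (0 : ℝ)..1, inner ℝ (g (s, S x s)) (Z y s) := by
  let N (x : X) : C(ℝ, E) := g.comp ((ContinuousMap.id ℝ).prodMk (S x))
  have hS : Continuous S := S.continuous_of_finiteDimensional
  have hN : Continuous N := ContinuousMap.continuous_of_continuous_uncurry _ (by
    have : Continuous fun p : X × ℝ => S p.1 p.2 := by fun_prop
    exact g.continuous.comp (continuous_snd.prodMk this))
  obtain ⟨x, hx, hweak⟩ := exists_inner_galerkin (toL2.toLinearMap ∘ₗ Z) (toL2.continuous.comp hN)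
    fun x => norm_toL2_le fun s _ => hm _
  exact ⟨x, hx, fun y => by simpa [inner_toL2, N] using hweak y⟩

end Galerkin

section ReferenceInterval

variable {E : Type*} [NormedAddCommGroup E] [InnerProductSpace ℝ E]

/-- The function `s ↦ ρ(s) c`, where `ρ` is the Radau polynomial of degree `N`, as a linear map of
`c`. -/
noncomputable def radauLift (N : ℕ) : E →ₗ[ℝ] C(ℝ, E) where
  toFun c := (radau N).toContinuousMap • ContinuousMap.const ℝ c
  map_add' c d := by ext s; simp
  map_smul' a c := by ext s; simp [smul_comm a]

theorem radauLift_apply (N : ℕ) (c : E) (s : ℝ) : radauLift N c s = (radau N).eval s • c := rfl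

theorem norm_radauLift_le {N : ℕ} (hN : N ≠ 0) (c : E) {s : ℝ} (hs : s ∈ Icc (0 : ℝ) 1) :
    ‖radauLift N c s‖ ≤ ‖c‖ := by
  rw [radauLift_apply, norm_smul]
  exact mul_le_of_le_one_left (norm_nonneg c) (abs_eval_radau_le_one hN hs)

theorem primitive_add_radauLift_zero (N : ℕ) (Z : C(ℝ, E)) (c : E) :
    (primitive Z + radauLift N c) 0 = c := by
  rw [ContinuousMap.add_apply, primitive_zero, radauLift_apply, eval_zero_radau, one_smul, zero_add]

theorem norm_primitive_add_radauLift_le_add {N : ℕ} (hN : N ≠ 0) (Z : C(ℝ, E)) (c : E) {s : ℝ}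
    (hs : s ∈ Icc (0 : ℝ) 1) : ‖(primitive Z + radauLift N c) s‖ ≤ ‖toL2 Z‖ + ‖c‖ :=
  norm_add_le_of_le (norm_primitive_le_norm_toL2 Z hs) (norm_radauLift_le hN c hs)

theorem exists_polynomial_eval_eq_inner {r : ℕ} {V : C(ℝ, E)} (hV : V ∈ polySubmodule E r)
    (c : E) : ∃ q : ℝ[X], q.natDegree ≤ r ∧ ∀ s, q.eval s = inner ℝ c (V s) := by
  obtain ⟨x, rfl⟩ := hV
  refine ⟨∑ i : Fin (r + 1), Polynomial.C (inner ℝ c (x i)) * Polynomial.X ^ (i : ℕ),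
    Polynomial.natDegree_sum_le_of_forall_le _ _ fun i _ =>
      (Polynomial.natDegree_C_mul_X_pow_le _ _).trans (by omega), fun s => ?_⟩
  rw [Polynomial.eval_finsetSum, polyMap_apply, inner_sum]
  exact Finset.sum_congr rfl fun i _ => by
    rw [real_inner_smul_right, Polynomial.eval_mul, Polynomial.eval_C, Polynomial.eval_pow,
      Polynomial.eval_X, mul_comm]

theorem integral_inner_derivative_radau_smul {r : ℕ} {V : C(ℝ, E)} (hV : V ∈ polySubmodule E r)
    (c : E) : ∫ s in (0 : ℝ)..1, inner ℝ ((radau (r + 1)).derivative.eval s • c) (V s) =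
      -inner ℝ c (V 0) := by
  obtain ⟨q, hq, hqV⟩ := exists_polynomial_eval_eq_inner hV c
  simp_rw [real_inner_smul_left, ← hqV]
  exact integral_derivative_radau_mul (Nat.lt_succ_of_le hq)

theorem integral_inner_deriv_self {u : C(ℝ, E)} {u' : ℝ → E} (hu : ∀ s, HasDerivAt u (u' s) s)
    (hu' : Continuous u') (a b : ℝ) :
    ∫ s in a..b, inner ℝ (deriv u s) (u s) = (‖u b‖ ^ 2 - ‖u a‖ ^ 2) / 2 := by
  have hsq (s : ℝ) : HasDerivAt (fun s => ‖u s‖ ^ 2 / 2) (inner ℝ (u' s) (u s)) s := by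
    simpa [real_inner_comm] using (hu s).norm_sq.div_const 2
  simp_rw [fun s => (hu s).deriv]
  rw [intervalIntegral.integral_eq_sub_of_hasDerivAt (fun s _ => hsq s)
    (Continuous.intervalIntegrable (by fun_prop) _ _), sub_div]

variable [CompleteSpace E]

theorem hasDerivAt_primitive_add_radauLift (N : ℕ) (Z : C(ℝ, E)) (c : E) (s : ℝ) :
    HasDerivAt (primitive Z + radauLift N c : C(ℝ, E))
      (Z s + (radau N).derivative.eval s • c) s :=
  (hasDerivAt_primitive Z s).add (((radau N).hasDerivAt s).smul_const c)

-- The derivative of the Radau polynomial cancels the jump term.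
theorem integral_inner_deriv_add_inner_zero {r : ℕ} (Z : C(ℝ, E)) (c : E) {V : C(ℝ, E)}
    (hV : V ∈ polySubmodule E r) :
    (∫ s in (0 : ℝ)..1, inner ℝ (deriv (primitive Z + radauLift (r + 1) c : C(ℝ, E)) s) (V s)) +
        inner ℝ c (V 0) = ∫ s in (0 : ℝ)..1, inner ℝ (Z s) (V s) := by
  simp_rw [(hasDerivAt_primitive_add_radauLift (r + 1) Z c _).deriv, inner_add_left]
  rw [intervalIntegral.integral_add (Continuous.intervalIntegrable (by fun_prop) _ _)
    (Continuous.intervalIntegrable (by fun_prop) _ _), integral_inner_derivative_radau_smul hV]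
  ring

-- The coefficients of `t ^ (r + 1)` in the two summands cancel for the right choice of `c`.
theorem exists_primitive_add_radauLift_mem (r : ℕ) :
    ∃ c : (Fin (r + 1) → E) →ₗ[ℝ] E,
      ∀ x, primitive (polyMap r x) + radauLift (r + 1) (c x) ∈ polySubmodule E r := by
  let a : ℝ := -(((r : ℝ) + 1) * radauCoeff (r + 1) (r + 1))⁻¹
  have ha : ((r : ℝ) + 1)⁻¹ + a * radauCoeff (r + 1) (r + 1) = 0 := by
    have := radauCoeff_ne_zero (le_refl (r + 1))
    simp only [a]
    field_simp
    ring
  let p (i : Fin (r + 1)) : ℝ[X] :=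
    Polynomial.C ((i : ℝ) + 1)⁻¹ * Polynomial.X ^ (i + 1 : ℕ) +
      if i = Fin.last r then Polynomial.C a * radau (r + 1) else 0
  have hp (i : Fin (r + 1)) : (p i).natDegree ≤ r := by
    rw [Polynomial.natDegree_le_iff_coeff_eq_zero]
    intro n hn
    rcases eq_or_ne i (Fin.last r) with rfl | hi
    · rcases (Nat.succ_le_of_lt hn).eq_or_lt with rfl | hn'
      · simpa [p, coeff_radau] using ha
      · simp [p, coeff_radau, radauCoeff_eq_zero_of_lt hn', hn'.ne']
    · have : (i : ℕ) ≠ r := fun h => hi (Fin.ext h)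
      have : n ≠ i + 1 := by omega
      simp [p, hi, this]
  refine ⟨a • LinearMap.proj (Fin.last r), fun x =>
    mem_polySubmodule_of_sum_eval_smul hp (v := x) fun t => ?_⟩
  simp only [p, ContinuousMap.add_apply, primitive_polyMap_apply, radauLift_apply,
    Polynomial.eval_add, add_smul, Finset.sum_add_distrib]
  congr 1
  · simp [mul_smul, smul_comm _ (t ^ _)]
  · simp [apply_ite (Polynomial.eval t), mul_smul, smul_comm a]

theorem norm_le_of_primitive_add_radauLift_mem {r : ℕ} {Z : C(ℝ, E)} {c : E}
    (hW : primitive Z + radauLift (r + 1) c ∈ polySubmodule E r) : ‖c‖ ≤ 3 * ‖toL2 Z‖ := by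
  set W := primitive Z + radauLift (r + 1) c with hWdef
  have henergy : (‖W 1‖ ^ 2 + ‖c‖ ^ 2) / 2 = inner ℝ (toL2 Z) (toL2 W) := by
    -- The weak form, tested with `W` itself.
    have hweak := integral_inner_deriv_add_inner_zero Z c hW
    rw [← hWdef, integral_inner_deriv_self (hasDerivAt_primitive_add_radauLift (r + 1) Z c)
      (by fun_prop), hWdef, primitive_add_radauLift_zero, ← hWdef, real_inner_self_eq_norm_sq,
      ← inner_toL2] at hweak
    linarith
  have hcs : inner ℝ (toL2 Z) (toL2 W) ≤ ‖toL2 Z‖ * (‖toL2 Z‖ + ‖c‖) :=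
    (real_inner_le_norm _ _).trans (by
      gcongr
      exact norm_toL2_le fun s => norm_primitive_add_radauLift_le_add r.succ_ne_zero Z c)
  nlinarith [norm_nonneg c, norm_nonneg (toL2 Z), sq_nonneg ‖W 1‖]

theorem norm_primitive_add_radauLift_le {r : ℕ} {Z : C(ℝ, E)} {c : E}
    (hW : primitive Z + radauLift (r + 1) c ∈ polySubmodule E r) {s : ℝ} (hs : s ∈ Icc (0 : ℝ) 1) :
    ‖(primitive Z + radauLift (r + 1) c) s‖ ≤ 4 * ‖toL2 Z‖ :=
  calc ‖(primitive Z + radauLift (r + 1) c) s‖ ≤ ‖toL2 Z‖ + ‖c‖ :=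
        norm_primitive_add_radauLift_le_add r.succ_ne_zero Z c hs
    _ ≤ ‖toL2 Z‖ + 3 * ‖toL2 Z‖ := by gcongr; exact norm_le_of_primitive_add_radauLift_mem hW
    _ = 4 * ‖toL2 Z‖ := by ring

end ReferenceInterval

section UnitIntervalSchemes

variable {E : Type*} [NormedAddCommGroup E] [InnerProductSpace ℝ E] [FiniteDimensional ℝ E]

theorem exists_cg_unitInterval (r : ℕ) (g : C(ℝ × E, E)) {m : ℝ} (hm : ∀ p, ‖g p‖ ≤ m) :
    ∃ W ∈ polySubmodule E (r + 1), W 0 = 0 ∧ (∀ s ∈ Icc (0 : ℝ) 1, ‖W s‖ ≤ m) ∧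
      ∀ V ∈ polySubmodule E r, ∫ s in (0 : ℝ)..1, inner ℝ (deriv W s) (V s) =
        ∫ s in (0 : ℝ)..1, inner ℝ (g (s, W s)) (V s) := by
  have := FiniteDimensional.complete ℝ E
  obtain ⟨x, hx, hweak⟩ := exists_integral_galerkin (polyMap r) (primitive ∘ₗ polyMap r) g hm
  refine ⟨primitive (polyMap r x), primitive_polyMap_mem x, primitive_zero _,
    fun s hs => (norm_primitive_le_norm_toL2 _ hs).trans hx, ?_⟩
  rintro _ ⟨y, rfl⟩
  simpa only [(hasDerivAt_primitive (polyMap r x) _).deriv, LinearMap.comp_apply] using hweak y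

theorem exists_dg_unitInterval (r : ℕ) (g : C(ℝ × E, E)) {m : ℝ} (hm : ∀ p, ‖g p‖ ≤ m) :
    ∃ W ∈ polySubmodule E r, (∀ s ∈ Icc (0 : ℝ) 1, ‖W s‖ ≤ 4 * m) ∧
      ∀ V ∈ polySubmodule E r,
        (∫ s in (0 : ℝ)..1, inner ℝ (deriv W s) (V s)) + inner ℝ (W 0) (V 0) =
          ∫ s in (0 : ℝ)..1, inner ℝ (g (s, W s)) (V s) := by
  have := FiniteDimensional.complete ℝ E
  obtain ⟨c, hc⟩ := exists_primitive_add_radauLift_mem (E := E) r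
  obtain ⟨x, hx, hweak⟩ := exists_integral_galerkin (polyMap r)
    (primitive ∘ₗ polyMap r + radauLift (r + 1) ∘ₗ c) g hm
  refine ⟨_, hc x, fun s hs => (norm_primitive_add_radauLift_le (hc x) hs).trans (by gcongr), ?_⟩
  rintro _ ⟨y, rfl⟩
  rw [primitive_add_radauLift_zero, integral_inner_deriv_add_inner_zero _ _ (polyMap_mem y)]
  exact hweak y

end UnitIntervalSchemes

section Localization

theorem exists_boundedContinuousFunction_eqOn {X E : Type*} [TopologicalSpace X] [T2Space X]
    [NormalSpace X] [NormedAddCommGroup E] [NormedSpace ℝ E] [FiniteDimensional ℝ E] {K : Set X}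
    (hK : IsCompact K) {f : X → E} (hf : ContinuousOn f K) :
    ∃ g : BoundedContinuousFunction X E, EqOn g f K := by
  have : CompactSpace K := isCompact_iff_compactSpace.1 hK
  obtain ⟨g, -, hg⟩ := BoundedContinuousFunction.exists_norm_eq_domRestrict_eq hK.isClosed ℝ
    (BoundedContinuousFunction.mkOfCompact ⟨K.domRestrict f, hf.domRestrict⟩)
  exact ⟨g, fun x hx => congr($hg ⟨x, hx⟩)⟩

variable {H : Type*} [NormedAddCommGroup H] [InnerProductSpace ℝ H] {Hm : Submodule ℝ H}
  [FiniteDimensional ℝ Hm] {a T : ℝ} {F : ℝ → H → H}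

theorem exists_bounded_rescaling
    (hF : ContinuousOn (Function.uncurry F) (Icc a T ×ˢ (Hm : Set H))) (u₀ : Hm) :
    ∃ kmax : ℝ, 0 < kmax ∧ ∀ k, 0 < k → k ≤ kmax → a + k ≤ T →
      ∃ g : C(ℝ × Hm, Hm), (∀ p, ‖g p‖ ≤ 1 / 4) ∧
        ∀ s ∈ Icc (0 : ℝ) 1, ∀ w : Hm, ‖w‖ ≤ 1 →
          g (s, w) = k • Hm.orthogonalProjectionOnto (F (a + k * s) ((u₀ + w : Hm) : H)) := by
  have := FiniteDimensional.proper_real Hm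
  have hcont : ContinuousOn (fun p : ℝ × Hm => Hm.orthogonalProjectionOnto (F p.1 p.2))
      (Icc a T ×ˢ closedBall u₀ 1) :=
    Hm.orthogonalProjectionOnto.continuous.comp_continuousOn
      (hF.comp (f := fun p : ℝ × Hm => (p.1, (p.2 : H))) (by fun_prop)
        fun p hp => ⟨hp.1, p.2.2⟩)
  obtain ⟨G, hG⟩ := exists_boundedContinuousFunction_eqOn
    (isCompact_Icc.prod (isCompact_closedBall u₀ 1)) hcont
  refine ⟨1 / (4 * (‖G‖ + 1)), by positivity, fun k hk hkmax hkT =>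
    ⟨⟨fun p => k • G (a + k * p.1, u₀ + p.2), by fun_prop⟩, fun p => ?_, fun s hs w hw => ?_⟩⟩
  · rw [le_div_iff₀ (by positivity)] at hkmax
    calc ‖k • G (a + k * p.1, u₀ + p.2)‖ ≤ k * ‖G‖ := by
          rw [norm_smul, Real.norm_of_nonneg hk.le]
          gcongr
          exact G.norm_coe_le_norm _
      _ ≤ 1 / 4 := by linarith
  · have hmem : (a + k * s, u₀ + w) ∈ Icc a T ×ˢ closedBall u₀ 1 :=
      ⟨⟨by nlinarith [hs.1], by nlinarith [hs.2]⟩, by simpa using hw⟩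
    exact congrArg (k • ·) (hG hmem)

end Localization

section Transport

theorem setIntegral_Ioo_eq_unitInterval {E : Type*} [NormedAddCommGroup E] [NormedSpace ℝ E]
    {a k : ℝ} (hk : 0 < k) (φ : ℝ → E) :
    ∫ t in Ioo a (a + k), φ t = ∫ s in (0 : ℝ)..1, k • φ (a + k * s) := by
  rw [← integral_Ioc_eq_integral_Ioo, ← intervalIntegral.integral_of_le (by linarith),
    intervalIntegral.integral_smul, intervalIntegral.smul_integral_comp_add_mul]
  simp

variable {H : Type*} [NormedAddCommGroup H] [InnerProductSpace ℝ H] {Hm : Submodule ℝ H}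
  {a k : ℝ} {r : ℕ}

theorem coe_mem_polySpace {f : C(ℝ, Hm)} (hf : f ∈ polySubmodule Hm r) (J : Set ℝ) :
    (fun t => (f t : H)) ∈ polySpace r J Hm := by
  refine ⟨by fun_prop, ?_⟩
  obtain ⟨x, rfl⟩ := hf
  exact ⟨x, fun t _ => by simp [polyMap_apply]⟩

theorem rightLim_eq_of_mem_polySpace (hk : 0 < k) {V : ℝ → H}
    (hV : V ∈ polySpace r (Ioo a (a + k)) Hm) : Function.rightLim V a = V a := by
  have hVc := hV.1
  rw [closure_Ioo (by linarith)] at hVc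
  exact ((hVc a ⟨le_rfl, by linarith⟩).mono_of_mem_nhdsWithin
    (Icc_mem_nhdsGE (by linarith : a < a + k))).rightLim_eq

theorem exists_polySubmodule_of_mem_polySpace (hk : 0 < k) {V : ℝ → H}
    (hV : V ∈ polySpace r (Ioo a (a + k)) Hm) :
    ∃ v ∈ polySubmodule Hm r, ∀ s ∈ Icc (0 : ℝ) 1, V (a + k * s) = v s := by
  obtain ⟨-, x, hx⟩ := hV
  rw [closure_Ioo (by linarith)] at hx
  refine ⟨_, comp_affine_mem_polySubmodule (polyMap_mem x) a k, fun s hs => ?_⟩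
  rw [hx _ ⟨by nlinarith [hs.1], by nlinarith [hs.2]⟩]
  simp [polyMap_apply]

/-- The function `u₀ + W` on the unit interval, transported to `(a, a + k)`. -/
noncomputable def transport (a k : ℝ) (u₀ : Hm) (W : C(ℝ, Hm)) (t : ℝ) : H :=
  ((u₀ + W (-(k⁻¹ * a) + k⁻¹ * t) : Hm) : H)

theorem transport_add_mul (hk : k ≠ 0) (u₀ : Hm) (W : C(ℝ, Hm)) (s : ℝ) :
    transport a k u₀ W (a + k * s) = ((u₀ + W s : Hm) : H) := by
  rw [transport, mul_add, inv_mul_cancel_left₀ hk, neg_add_cancel_left]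

theorem transport_left (hk : k ≠ 0) (u₀ : Hm) (W : C(ℝ, Hm)) :
    transport a k u₀ W a = ((u₀ + W 0 : Hm) : H) := by
  simpa using transport_add_mul (a := a) hk u₀ W 0

theorem transport_mem_polySpace (a k : ℝ) (u₀ : Hm) {W : C(ℝ, Hm)} (hW : W ∈ polySubmodule Hm r)
    (J : Set ℝ) : transport a k u₀ W ∈ polySpace r J Hm :=
  coe_mem_polySpace (add_mem (const_mem_polySubmodule r u₀) (comp_affine_mem_polySubmodule hW _ _))
    J

theorem integral_inner_deriv_transport (hk : 0 < k) (u₀ : Hm) {W : C(ℝ, Hm)}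
    (hW : Differentiable ℝ W) {V : ℝ → H} {v : C(ℝ, Hm)}
    (hV : ∀ s ∈ Icc (0 : ℝ) 1, V (a + k * s) = v s) :
    ∫ t in Ioo a (a + k), inner ℝ (deriv (transport a k u₀ W) t) (V t) =
      ∫ s in (0 : ℝ)..1, inner ℝ (deriv W s) (v s) := by
  have hderiv (s : ℝ) : deriv (transport a k u₀ W) (a + k * s) = (k⁻¹ • deriv W s : Hm) := by
    have hs : -(k⁻¹ * a) + k⁻¹ * (a + k * s) = s := by
      rw [mul_add, inv_mul_cancel_left₀ hk.ne', neg_add_cancel_left]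
    have haff : HasDerivAt (fun t => -(k⁻¹ * a) + k⁻¹ * t) k⁻¹ (a + k * s) := by
      simpa using ((hasDerivAt_id (a + k * s)).const_mul k⁻¹).const_add (-(k⁻¹ * a))
    have hcomp := HasDerivAt.scomp_of_eq (a + k * s) (hW s).hasDerivAt haff hs.symm
    exact (Hm.subtypeL.hasFDerivAt.comp_hasDerivAt _ (hcomp.const_add u₀)).deriv
  rw [setIntegral_Ioo_eq_unitInterval hk]
  refine intervalIntegral.integral_congr fun s hs => ?_
  rw [uIcc_of_le zero_le_one] at hs
  simp only [hderiv, hV s hs, ← Submodule.coe_inner, real_inner_smul_left, smul_eq_mul]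
  rw [mul_inv_cancel_left₀ hk.ne']

variable [FiniteDimensional ℝ Hm] {F : ℝ → H → H}

theorem integral_inner_rhs_transport (hk : 0 < k) {u₀ : Hm} {g : C(ℝ × Hm, Hm)}
    (hg : ∀ s ∈ Icc (0 : ℝ) 1, ∀ w : Hm, ‖w‖ ≤ 1 →
      g (s, w) = k • Hm.orthogonalProjectionOnto (F (a + k * s) ((u₀ + w : Hm) : H)))
    {W : C(ℝ, Hm)} (hW : ∀ s ∈ Icc (0 : ℝ) 1, ‖W s‖ ≤ 1) {V : ℝ → H} {v : C(ℝ, Hm)}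
    (hV : ∀ s ∈ Icc (0 : ℝ) 1, V (a + k * s) = v s) :
    ∫ t in Ioo a (a + k), inner ℝ (F t (transport a k u₀ W t)) (V t) =
      ∫ s in (0 : ℝ)..1, inner ℝ (g (s, W s)) (v s) := by
  rw [setIntegral_Ioo_eq_unitInterval hk]
  refine intervalIntegral.integral_congr fun s hs => ?_
  rw [uIcc_of_le zero_le_one] at hs
  simp only [hg s hs _ (hW s hs), transport_add_mul hk.ne', hV s hs, real_inner_smul_left,
    Submodule.inner_orthogonalProjectionOnto_eq_of_mem_right, smul_eq_mul]

end Transport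

section Existence

variable {H : Type*} [NormedAddCommGroup H] [InnerProductSpace ℝ H] {Hm : Submodule ℝ H}
  [FiniteDimensional ℝ Hm] {a T : ℝ} {F : ℝ → H → H}

theorem exists_isCGSolution
    (hF : ContinuousOn (Function.uncurry F) (Icc a T ×ˢ (Hm : Set H))) (Uprev : H) :
    ∃ kmax : ℝ, 0 < kmax ∧ ∀ k, 0 < k → k ≤ kmax → a + k ≤ T → ∀ r : ℕ,
      ∃ U : ℝ → H, IsCGSolution F Hm a k r Uprev U := by
  let u₀ := Hm.orthogonalProjectionOnto Uprev
  obtain ⟨kmax, hkmax, hloc⟩ := exists_bounded_rescaling hF u₀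
  refine ⟨kmax, hkmax, fun k hk hkk hkT r => ?_⟩
  obtain ⟨g, hg, hgF⟩ := hloc k hk hkk hkT
  obtain ⟨W, hW, hW0, hWle, hweak⟩ := exists_cg_unitInterval r g hg
  refine ⟨transport a k u₀ W, transport_mem_polySpace a k u₀ hW _, ?_, fun V hV => ?_⟩
  · rw [transport_left hk.ne', hW0, add_zero]
    rfl
  · obtain ⟨v, hv, hVv⟩ := exists_polySubmodule_of_mem_polySpace hk hV
    rw [integral_inner_deriv_transport hk u₀ (differentiable_of_mem_polySubmodule hW) hVv,
      integral_inner_rhs_transport hk hgF (fun s hs => (hWle s hs).trans (by norm_num)) hVv]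
    exact hweak v hv

theorem exists_isDGSolution
    (hF : ContinuousOn (Function.uncurry F) (Icc a T ×ˢ (Hm : Set H))) (Uprev : H) :
    ∃ kmax : ℝ, 0 < kmax ∧ ∀ k, 0 < k → k ≤ kmax → a + k ≤ T → ∀ r : ℕ,
      ∃ U : ℝ → H, IsDGSolution F Hm a k r Uprev U := by
  let u₀ := Hm.orthogonalProjectionOnto Uprev
  obtain ⟨kmax, hkmax, hloc⟩ := exists_bounded_rescaling hF u₀
  refine ⟨kmax, hkmax, fun k hk hkk hkT r => ?_⟩
  obtain ⟨g, hg, hgF⟩ := hloc k hk hkk hkT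
  obtain ⟨W, hW, hWle, hweak⟩ := exists_dg_unitInterval r g hg
  have hmem := transport_mem_polySpace a k u₀ hW (Ioo a (a + k))
  refine ⟨transport a k u₀ W, hmem, fun V hV => ?_⟩
  obtain ⟨v, hv, hVv⟩ := exists_polySubmodule_of_mem_polySpace hk hV
  have hV0 : V a = v 0 := by simpa using hVv 0 (by simp)
  have hjump : inner ℝ (transport a k u₀ W a - Uprev) (V a) = inner ℝ (W 0) (v 0) := by
    rw [transport_left hk.ne', hV0, inner_sub_left, ← Submodule.coe_inner, inner_add_left,
      Submodule.inner_orthogonalProjectionOnto_eq_of_mem_right, add_sub_cancel_left]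
  rw [rightLim_eq_of_mem_polySpace hk hmem, rightLim_eq_of_mem_polySpace hk hV, hjump,
    integral_inner_deriv_transport hk u₀ (differentiable_of_mem_polySubmodule hW) hVv,
    integral_inner_rhs_transport hk hgF (fun s hs => (hWle s hs).trans (by norm_num)) hVv]
  exact hweak v hv

end Existence

end GalerkinTimeStepping

theorem theorem3p1_general {H : Type*} [NormedAddCommGroup H] [InnerProductSpace ℝ H]
    {T a : ℝ} {F : ℝ → H → H} {Hm : Submodule ℝ H} [FiniteDimensional ℝ Hm]
    (hF : ContinuousOn (Function.uncurry F) (Set.Icc a T ×ˢ (Hm : Set H)))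
    (UprevCG UprevDG : H) :
    ∃ kmax : ℝ, 0 < kmax ∧ ∀ k : ℝ, 0 < k → k ≤ kmax → a + k ≤ T → ∀ r : ℕ,
      (∃ U : ℝ → H, GalerkinTimeStepping.IsCGSolution F Hm a k r UprevCG U) ∧
      (∃ U : ℝ → H, GalerkinTimeStepping.IsDGSolution F Hm a k r UprevDG U) := by
  obtain ⟨k₁, hk₁, hcg⟩ := GalerkinTimeStepping.exists_isCGSolution hF UprevCG
  obtain ⟨k₂, hk₂, hdg⟩ := GalerkinTimeStepping.exists_isDGSolution hF UprevDG
  exact ⟨min k₁ k₂, lt_min hk₁ hk₂, fun k hk hkk hkT r =>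
    ⟨hcg k hk (hkk.trans (min_le_left _ _)) hkT r, hdg k hk (hkk.trans (min_le_right _ _)) hkT r⟩⟩

theorem theorem3p1 {H : Type*} [NormedAddCommGroup H] [InnerProductSpace ℝ H] [CompleteSpace H]
    (T : ℝ) (F : ℝ → H → H)
    (hF : ContinuousOn (Function.uncurry F) (Set.Icc 0 T ×ˢ Set.univ))
    (Hm : Submodule ℝ H) [FiniteDimensional ℝ Hm]
    (a : ℝ) (ha : 0 ≤ a) (haT : a < T) (UprevCG UprevDG : H) :
    ∃ kmax : ℝ, 0 < kmax ∧ ∀ k : ℝ, 0 < k → k ≤ kmax → a + k ≤ T → ∀ r : ℕ,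
      (∃ U : ℝ → H, GalerkinTimeStepping.IsCGSolution F Hm a k r UprevCG U) ∧
      (∃ U : ℝ → H, GalerkinTimeStepping.IsDGSolution F Hm a k r UprevDG U) := by
  exact theorem3p1_general
    (hF.mono (Set.prod_mono (Set.Icc_subset_Icc_left ha) (Set.subset_univ _))) UprevCG UprevDG
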